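/- Let $\mathbb{Z}^2$ denote the square lattice graph, whose vertices are the points of the plane with integer coordinates and whose edges join the points at distance $1$. Let $G$ be a finite connected subgraph of $\mathbb{Z}^2$ (not necessarily induced), and let $R_2$ be the rotation by $180$ degrees about the center of some unit square of the lattice. Suppose that $G$ is 2-even symmetric with respect to $R_2$; that is, $G$ is a connected planar bipartite graph, $R_2$ maps $G$ to itself, and for every vertex $v$ of $G$ every path in $G$ from $v$ to $R_2(v)$ has even length. (For such subgraphs of $\mathbb{Z}^2$, planarity, bipartiteness and the parity condition hold automatically.) Then the number of perfect matchings of $G$ is a sum of two integer squares: there exist integers $a,b$ such that this number equals $a^2+b^2$. -/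

import Mathlib

/-- The square lattice: the infinite graph on `ℤ × ℤ` whose edges join the points at
Euclidean (equivalently, `ℓ¹`) distance `1`. -/
def squareLattice : SimpleGraph (ℤ × ℤ) where
  Adj p q := |p.1 - q.1| + |p.2 - q.2| = 1
  symm := ⟨fun p q h => by rw [abs_sub_comm q.1, abs_sub_comm q.2]; exact h⟩
  loopless := ⟨fun p h => by simp at h⟩

/-- The rotation by 180 degrees about the center `(c.1 + 1/2, c.2 + 1/2)` of the unit square with
lower left corner `c`, as an automorphism of the square lattice. -/
def halfTurn (c : ℤ × ℤ) : squareLattice ≃g squareLattice where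
  toFun p := (2 * c.1 + 1 - p.1, 2 * c.2 + 1 - p.2)
  invFun p := (2 * c.1 + 1 - p.1, 2 * c.2 + 1 - p.2)
  left_inv p := by ext <;> simp
  right_inv p := by ext <;> simp
  map_rel_iff' {p q} := by
    simp only [squareLattice, Equiv.coe_fn_mk, sub_sub_sub_cancel_left]
    rw [abs_sub_comm q.1, abs_sub_comm q.2]

/-- The center of the unit square with lower left corner `c` is the midpoint of every lattice
point and its image, so `halfTurn c` is the point reflection (half-turn) about that center. -/
theorem halfTurn_midpoint (c p : ℤ × ℤ) :
    midpoint ℝ ((p.1 : ℝ), (p.2 : ℝ)) (((halfTurn c p).1 : ℝ), ((halfTurn c p).2 : ℝ)) =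
      ((c.1 : ℝ) + 1 / 2, (c.2 : ℝ) + 1 / 2) := by
  rw [midpoint_eq_smul_add]
  ext <;> simp [halfTurn] <;> ring

/-- `G` is a 2-even symmetric graph embedded in the square lattice, where the center of rotation is
the center of the unit square with lower left corner `c`. As a subgraph of the square lattice,
`G` is drawn in the plane without crossings, so planarity needs no separate clause. -/
structure IsTwoEvenSymmetric (c : ℤ × ℤ) (G : squareLattice.Subgraph) : Prop where
  connected : G.Connected
  bipartite : G.coe.IsBipartite
  /-- The half-turn maps the vertex set and the edge set of `G` onto themselves. -/
  map_halfTurn : G.map (halfTurn c).toHom = G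
  /-- Every path in `G` from a vertex to its image under the half-turn has even length. -/
  even_length : ∀ v w : G.verts, (w : ℤ × ℤ) = halfTurn c (v : ℤ × ℤ) →
    ∀ p : G.coe.Walk v w, p.IsPath → Even p.length

/-- The number of perfect matchings of a (finite) graph. -/
noncomputable def numPerfectMatchings {V : Type*} (G : SimpleGraph V) : ℕ :=
  {M : G.Subgraph | M.IsPerfectMatching}.ncard

/-! Number the vertices row by row. The half-turn becomes the reversal of `0, …, N - 1`, a
horizontal edge joins consecutive numbers, and a vertical edge is an arc under which only horizontal
edges can nest. For such arc diagrams, explicit signs depending only on the endpoints give all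
perfect matchings the same sign in the determinant of the signed biadjacency matrix, so its absolute
value is the number of matchings (`abs_det_arcWeight`). Reversal multiplies the signed weight of
`{u, v}` by `(-1) ^ (u + v)` (`arcWeight_rev`). Grouping each colour class into even numbers and
their reversals, which are odd, turns the matrix into blocks `P, Q, -Q, P`, with determinant `|det
(P + iQ)|²`, the norm of a Gaussian integer. -/

open Finset Matrix

/-! ### Block determinants over the Gaussian integers -/

/-- The determinant of a block matrix of complex shape is the norm of a Gaussian integer. -/
theorem exists_det_fromBlocks_eq_sq_add_sq {m : Type*} [Fintype m] [DecidableEq m]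
    (P Q : Matrix m m ℤ) :
    ∃ a b : ℤ, (fromBlocks P Q (-Q) P).det = a ^ 2 + b ^ 2 := by
  let i : GaussianInt := ⟨0, 1⟩
  have hi : i * i = -1 := by decide
  let f : ℤ →+* GaussianInt := Int.castRingHom _
  let P' : Matrix m m GaussianInt := P.map f
  let Q' : Matrix m m GaussianInt := Q.map f
  -- Add `i` times the second block row to the first, then subtract `i` times the first block column
  -- from the second.
  have hfact : fromBlocks 1 (i • (1 : Matrix m m GaussianInt)) 0 1 * fromBlocks P' Q' (-Q') P' *
      fromBlocks 1 (-(i • (1 : Matrix m m GaussianInt))) 0 1 =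
      fromBlocks (P' - i • Q') 0 (-Q') (P' + i • Q') := by
    simp only [fromBlocks_multiply]
    congr 1
    · simp [sub_eq_add_neg]
    · simp only [mul_one, mul_neg, one_mul, Matrix.smul_mul, Matrix.mul_smul, smul_neg, smul_add,
        smul_smul, hi]
      simp only [neg_smul, one_smul]
      abel
    · simp
    · simp [add_comm]
  have hconj : (P' - i • Q').det = star (P' + i • Q').det := by
    have h := RingHom.map_det (starRingEnd GaussianInt) (P' + i • Q')
    rw [starRingEnd_apply] at h
    rw [h]
    congr 1
    ext1 a b
    simp only [P', Q', f, RingHom.mapMatrix_apply, Matrix.map_apply, Matrix.sub_apply,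
      Matrix.add_apply, Matrix.smul_apply, smul_eq_mul, map_add, map_mul, starRingEnd_apply]
    ext <;> simp [i]
  have hdet : f (fromBlocks P Q (-Q) P).det = (P' - i • Q').det * (P' + i • Q').det := by
    rw [RingHom.map_det, ← det_fromBlocks_zero₁₂ _ (-Q'), ← hfact, det_mul, det_mul,
      det_fromBlocks_zero₂₁, det_fromBlocks_zero₂₁]
    simp only [det_one, one_mul, mul_one]
    congr 1
    rw [RingHom.mapMatrix_apply, fromBlocks_map]
    congr 1
  rw [hconj, mul_comm, ← Zsqrtd.norm_eq_mul_conj] at hdet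
  refine ⟨(P' + i • Q').det.re, (P' + i • Q').det.im, ?_⟩
  have := congrArg Zsqrtd.re hdet
  simp only [f, Int.coe_castRingHom, Zsqrtd.re_intCast, Zsqrtd.norm_def] at this
  rw [this]
  ring

/-! ### Perfect matchings as bijections of colour classes -/

theorem map_symm_map_iso {V W : Type*} {G : SimpleGraph V} {H : SimpleGraph W} (e : G ≃g H)
    (M : H.Subgraph) : (M.map e.symm.toHom).map e.toHom = M := by
  rw [← SimpleGraph.Subgraph.map_comp]
  convert M.map_id
  ext v
  simp

theorem SimpleGraph.Subgraph.IsPerfectMatching.map_iso {V W : Type*} {G : SimpleGraph V}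
    {H : SimpleGraph W} {M : G.Subgraph} (hM : M.IsPerfectMatching) (e : G ≃g H) :
    (M.map e.toHom).IsPerfectMatching :=
  ⟨(SimpleGraph.Subgraph.Iso.isMatching_map e).2 hM.1, fun w => ⟨e.symm w, hM.2 _, by simp⟩⟩

/-- Isomorphic graphs have equally many perfect matchings. -/
theorem numPerfectMatchings_congr {V W : Type*} {G : SimpleGraph V} {H : SimpleGraph W}
    (e : G ≃g H) : numPerfectMatchings G = numPerfectMatchings H := by
  refine Nat.card_congr
    { toFun := fun M => ⟨M.1.map e.toHom, M.2.map_iso e⟩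
      invFun := fun M => ⟨M.1.map e.symm.toHom, M.2.map_iso e.symm⟩
      left_inv := fun M => Subtype.ext (map_symm_map_iso e.symm M.1)
      right_inv := fun M => Subtype.ext (map_symm_map_iso e M.1) }

/-- Perfect matchings of a bipartite graph are bijections between the colour classes that respect
adjacency. -/
theorem numPerfectMatchings_eq_card_equiv {V : Type*} (G : SimpleGraph V) (p : V → Prop)
    (hp : ∀ u v, G.Adj u v → (p u ↔ ¬p v)) :
    numPerfectMatchings G =
      Nat.card {f : {v // p v} ≃ {v // ¬p v} // ∀ b : {v // p v}, G.Adj b (f b)} := by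
  symm
  let F : {f : {v // p v} ≃ {v // ¬p v} // ∀ b : {v // p v}, G.Adj b (f b)} →
      {M : G.Subgraph | M.IsPerfectMatching} := fun f =>
    ⟨{ verts := Set.univ
       Adj := fun u v => (∃ b : {v // p v}, u = b ∧ v = f.1 b) ∨
         ∃ b : {v // p v}, v = b ∧ u = f.1 b
       adj_sub := by
        rintro u v (⟨b, rfl, rfl⟩ | ⟨b, rfl, rfl⟩)
        · exact f.2 b
        · exact (f.2 b).symm
       edge_vert := fun _ => Set.mem_univ _
       symm := ⟨fun u v h => h.symm⟩ }, by
      refine SimpleGraph.Subgraph.isPerfectMatching_iff.2 fun v => ?_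
      by_cases hv : p v
      · refine ⟨f.1 ⟨v, hv⟩, Or.inl ⟨⟨v, hv⟩, rfl, rfl⟩, ?_⟩
        rintro w (⟨b, h, rfl⟩ | ⟨b, rfl, h⟩)
        · congr 2
          exact Subtype.ext h.symm
        · exact absurd hv (h ▸ (f.1 b).2)
      · refine ⟨f.1.symm ⟨v, hv⟩, Or.inr ⟨_, rfl, by simp⟩, ?_⟩
        rintro w (⟨b, h, rfl⟩ | ⟨b, rfl, h⟩)
        · exact absurd (h ▸ b.2) hv
        · congr 1
          rw [Equiv.eq_symm_apply]
          exact Subtype.ext h.symm⟩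
  refine Nat.card_congr (Equiv.ofBijective F ⟨fun f g hfg => ?_, fun M => ?_⟩)
  · refine Subtype.ext (Equiv.ext fun b => ?_)
    have h : (F g).1.Adj b (f.1 b) := by
      rw [← hfg]
      exact Or.inl ⟨b, rfl, rfl⟩
    obtain ⟨b', h1, h2⟩ | ⟨b', h1, -⟩ := h
    · rw [← Subtype.ext h1] at h2
      exact Subtype.ext h2
    · exact absurd b'.2 (h1 ▸ (f.1 b).2)
  · obtain ⟨M, hM⟩ := M
    have hM' := SimpleGraph.Subgraph.isPerfectMatching_iff.1 hM
    choose m hm hu using hM'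
    have hmm : ∀ v, m (m v) = v := fun v => (hu _ _ (hm v).symm).symm
    have hmp : ∀ v, p v ↔ ¬p (m v) := fun v => hp _ _ (M.adj_sub (hm v))
    let f : {v // p v} ≃ {v // ¬p v} :=
      { toFun := fun b => ⟨m b, (hmp b).1 b.2⟩
        invFun := fun w => ⟨m w, by have := hmp w; have := w.2; tauto⟩
        left_inv := fun b => Subtype.ext (hmm b)
        right_inv := fun b => Subtype.ext (hmm b) }
    refine ⟨⟨f, fun b => M.adj_sub (hm b)⟩, Subtype.ext ?_⟩
    refine SimpleGraph.Subgraph.ext ?_ ?_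
    · exact (Set.eq_univ_of_forall hM.2).symm
    · funext u v
      refine propext ⟨?_, fun h => ?_⟩
      · rintro (⟨b, rfl, rfl⟩ | ⟨b, rfl, rfl⟩)
        · exact hm b
        · exact (hm b).symm
      · have hv := hu _ _ h
        by_cases hpu : p u
        · exact Or.inl ⟨⟨u, hpu⟩, rfl, hv⟩
        · refine Or.inr ⟨⟨v, ?_⟩, rfl, hu _ _ h.symm⟩
          have := hp _ _ (M.adj_sub h)
          tauto

/-! ### Signed arc diagrams and their reversal -/

/-- The sign attached to an arc `{u, v}` and a point `k` of the line: arcs between consecutive points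
are neutral, and every other arc picks up a sign from each point to its left. -/
def arcSign (u v k : ℕ) : ℤ :=
  if u + 1 = v ∨ v + 1 = u then 1 else if k < min u v then -1 else 1

/-- The sign of the pair `u`, `v`, according to their order. -/
def ltSign (u v : ℕ) : ℤ := if u < v then -1 else 1

theorem arcSign_self (u v : ℕ) : arcSign u v u * arcSign u v v = 1 := by
  simp [arcSign]

/-- For two disjoint arcs `{p, r}` and `{q, s}` that do not nest unless the inner one is short, the
inversion sign is balanced by the arc signs. -/
theorem inversion_mul_arcSign {p q r s : ℕ} (hpq : p < q) (hrs : r ≠ s) (hps : p ≠ s)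
    (hqr : q ≠ r) (hpr : p ≠ r) (hqs : q ≠ s)
    (h₁ : min p r < min q s → max q s < max p r → q + 1 = s ∨ s + 1 = q)
    (h₂ : min q s < min p r → max p r < max q s → p + 1 = r ∨ r + 1 = p) :
    (if r < s then 1 else -1) *
      ((arcSign p r q * arcSign p r s) * (arcSign q s p * arcSign q s r)) =
      -(ltSign q r * ltSign p s) := by
  unfold arcSign ltSign
  rcases lt_or_gt_of_ne hrs with h | h <;> rcases lt_or_gt_of_ne hps with h' | h' <;>
    rcases lt_or_gt_of_ne hqr with h'' | h'' <;> rcases lt_or_gt_of_ne hpr with h3 | h3 <;>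
    rcases lt_or_gt_of_ne hqs with h4 | h4 <;> first | omega | skip
  all_goals
    simp only [min_eq_left, min_eq_right, max_eq_left, max_eq_right, h3.le, h4.le] at h₁ h₂ ⊢
    split_ifs <;> first | rfl | omega

/-- Every perfect matching of a system of arcs without nesting contributes the same sign to the
determinant. -/
theorem sign_mul_prod_eq {n : ℕ} {β ω : Fin n → ℕ} (hβ : StrictMono β) (hω : StrictMono ω)
    (hne : ∀ i j, β i ≠ ω j) (σ : Equiv.Perm (Fin n))
    (hnest : ∀ i j, min (β i) (ω (σ i)) < min (β j) (ω (σ j)) →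
      max (β j) (ω (σ j)) < max (β i) (ω (σ i)) → β j + 1 = ω (σ j) ∨ ω (σ j) + 1 = β j) :
    (Equiv.Perm.sign σ : ℤ) * ∏ i, (ltSign (β i) (ω (σ i)) *
      ∏ k, (arcSign (β i) (ω (σ i)) (β k) * arcSign (β i) (ω (σ i)) (ω k))) =
      (∏ i : Fin n, ∏ _j ∈ Ioi i, (-1 : ℤ)) * ∏ i, ∏ j, ltSign (β i) (ω j) := by
  -- `F j i` is the sign that arc `i` receives from the two ends of arc `j`; the diagonal is trivial
  -- by `arcSign_self`.
  let F : Fin n → Fin n → ℤ := fun j i =>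
    arcSign (β i) (ω (σ i)) (β j) * arcSign (β i) (ω (σ i)) (ω (σ j))
  have hF : ∀ i, ∏ k, (arcSign (β i) (ω (σ i)) (β k) * arcSign (β i) (ω (σ i)) (ω k)) =
      ∏ j ∈ {i}ᶜ, F j i := by
    intro i
    rw [prod_mul_distrib, ← Equiv.prod_comp σ (fun k => arcSign (β i) (ω (σ i)) (ω k)),
      ← prod_mul_distrib, ← prod_mul_prod_compl {i}]
    simp [F, arcSign_self]
  have hν : ∏ i, ∏ j, ltSign (β i) (ω j) =
      (∏ i, ltSign (β i) (ω (σ i))) * ∏ i, ∏ j ∈ {i}ᶜ, ltSign (β i) (ω (σ j)) := by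
    rw [← prod_mul_distrib]
    refine prod_congr rfl fun i _ => ?_
    rw [← Equiv.prod_comp σ (fun j => ltSign (β i) (ω j)), ← prod_mul_prod_compl {i}]
    simp
  rw [hν, prod_mul_distrib, mul_left_comm, mul_left_comm (∏ i : Fin n, ∏ _j ∈ Ioi i, (-1 : ℤ))]
  congr 1
  simp_rw [hF]
  -- Everything, including the sign of `σ`, is now a product over pairs `i < j`, and is compared
  -- pair by pair.
  rw [← prod_prod_Ioi_mul_eq_prod_prod_off_diag,
    ← prod_prod_Ioi_mul_eq_prod_prod_off_diag (fun j i => ltSign (β i) (ω (σ j))),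
    Equiv.Perm.sign_eq_prod_prod_Ioi]
  push_cast
  rw [← prod_mul_distrib, ← prod_mul_distrib]
  refine prod_congr rfl fun i _ => ?_
  rw [← prod_mul_distrib, ← prod_mul_distrib]
  refine prod_congr rfl fun j hj => ?_
  have hij : i < j := by simpa using hj
  have := inversion_mul_arcSign (hβ hij) (r := ω (σ i)) (s := ω (σ j))
    (fun h => hij.ne (σ.injective (hω.injective h))) (hne _ _) (hne _ _) (hne _ _) (hne _ _)
    (hnest i j) (hnest j i)
  simp only [hω.lt_iff_lt] at this
  simp only [F]
  rw [neg_one_mul, ← mul_comm (ltSign (β j) _), ← this]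
  split_ifs <;> push_cast <;> ring

/-- Recovers the closed-form sign of an arc from the point-by-point signs, which are what makes the
comparison local to pairs of arcs. -/
theorem prod_arcSign {N n : ℕ} {p : Fin N → Prop} [DecidablePred p] (eB : Fin n ≃ {v // p v})
    (eW : Fin n ≃ {v // ¬p v}) (u v : Fin N) :
    ∏ k, (arcSign u v (eB k).1 * arcSign u v (eW k).1) =
      if u.1 + 1 = v ∨ v.1 + 1 = u then 1 else (-1) ^ min u.1 v.1 := by
  rw [prod_mul_distrib, Equiv.prod_comp eB (fun b => arcSign u v b.1),
    Equiv.prod_comp eW (fun b => arcSign u v b.1),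
    Fintype.prod_subtype_mul_prod_subtype p (fun k => arcSign u v k)]
  by_cases h : u.1 + 1 = v ∨ v.1 + 1 = u
  · simp [arcSign, h]
  · simp only [arcSign, h, if_false]
    rw [Fin.prod_univ_eq_prod_range (fun k => if k < min u.1 v.1 then (-1 : ℤ) else 1) N,
      prod_ite, prod_const_one, mul_one, prod_const]
    congr 1
    have : {k ∈ range N | k < min u.1 v.1} = range (min u.1 v.1) := by
      ext k
      have := u.2
      simp only [mem_filter, mem_range]
      omega
    rw [this, card_range]

open Classical in
/-- The entries of a signed adjacency matrix for a graph drawn by arcs over `0, …, N - 1`. -/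
noncomputable def arcWeight {N : ℕ} (H : SimpleGraph (Fin N)) (u v : Fin N) : ℤ :=
  if H.Adj u v then
    ltSign u v * (if u.1 + 1 = v ∨ v.1 + 1 = u then 1 else (-1) ^ min u.1 v.1) else 0

/-- The nonzero Leibniz terms all equal one sign `C`, so nothing cancels. The enumerations must be
increasing for inversions of `σ` to reflect positions on the line. -/
theorem abs_det_arcWeight {N n : ℕ} {H : SimpleGraph (Fin N)} {p : Fin N → Prop}
    [DecidablePred p] (hp : ∀ u v, H.Adj u v → (p u ↔ ¬p v))
    (hnest : ∀ a b c d : Fin N, a < b → b < c → c < d → H.Adj a d → H.Adj b c → b.1 + 1 = c)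
    (eB : Fin n ≃o {v // p v}) (eW : Fin n ≃o {v // ¬p v}) :
    |(of fun i j => arcWeight H (eB i).1 (eW j).1).det| =
      numPerfectMatchings H := by
  classical
  have hcount : numPerfectMatchings H =
      #{σ : Equiv.Perm (Fin n) | ∀ i, H.Adj (eB i).1 (eW (σ i)).1} := by
    rw [numPerfectMatchings_eq_card_equiv H p hp, ← Fintype.card_subtype, ← Nat.card_eq_fintype_card]
    symm
    refine Nat.card_congr ((Equiv.equivCongr eB.toEquiv eW.toEquiv).subtypeEquiv fun σ => ?_)
    constructor
    · intro h b
      simpa using h (eB.symm b)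
    · intro h i
      simpa using h (eB i)
  let C : ℤ := (∏ i : Fin n, ∏ _j ∈ Ioi i, (-1 : ℤ)) * ∏ i, ∏ j, ltSign (eB i).1 (eW j).1
  have hC : |C| = 1 := by
    have : ∀ u v, |ltSign u v| = 1 := fun u v => by unfold ltSign; split_ifs <;> rfl
    simp [C, abs_mul, abs_prod, this]
  have hterm : ∀ σ : Equiv.Perm (Fin n),
      (Equiv.Perm.sign σ : ℤ) * ∏ i, arcWeight H (eB i).1 (eW (σ i)).1 =
        if ∀ i, H.Adj (eB i).1 (eW (σ i)).1 then C else 0 := by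
    intro σ
    split_ifs with h
    · have hadj : ∀ i j, (eB j).1.1 + 1 = (eW (σ j)).1.1 ∨ (eW (σ j)).1.1 + 1 = (eB j).1.1 ∨
          ¬(min (eB i).1.1 (eW (σ i)).1.1 < min (eB j).1.1 (eW (σ j)).1.1 ∧
            max (eB j).1.1 (eW (σ j)).1.1 < max (eB i).1.1 (eW (σ i)).1.1) := by
        intro i j
        have hi := h i
        have hj := h j
        have hi0 := hi.ne
        have hj0 := hj.ne
        generalize (eB i).1 = a at *
        generalize (eB j).1 = b at *
        generalize (eW (σ i)).1 = c at *
        generalize (eW (σ j)).1 = d at *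
        have k1 := hnest a b d c
        have k2 := hnest a d b c
        have k3 := hnest c b d a
        have k4 := hnest c d b a
        simp only [hi, hi.symm, hj, hj.symm, forall_true_left, Fin.lt_def] at k1 k2 k3 k4
        rw [Ne, Fin.ext_iff] at hi0 hj0
        omega
      have := sign_mul_prod_eq (β := fun i => (eB i).1.1) (ω := fun i => (eW i).1.1)
        (fun i j hij => eB.strictMono hij) (fun i j hij => eW.strictMono hij)
        (fun i j hij => (eW j).2 (by rw [← Fin.ext hij]; exact (eB i).2)) σ
        (fun i j h1 h2 => by have := hadj i j; tauto)
      refine Eq.trans ?_ this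
      congr 1
      refine prod_congr rfl fun i _ => ?_
      have := prod_arcSign eB.toEquiv eW.toEquiv (eB i).1 (eW (σ i)).1
      simp only [RelIso.coe_fn_toEquiv] at this
      rw [arcWeight, if_pos (h i), this]
    · rw [not_forall] at h
      obtain ⟨i, hi⟩ := h
      rw [prod_eq_zero (mem_univ i) (by rw [arcWeight, if_neg hi]), mul_zero]
  rw [← det_transpose, det_apply']
  simp only [transpose_apply, of_apply, Int.cast_id]
  rw [sum_congr rfl fun σ _ => hterm σ]
  rw [← sum_filter, sum_const, hcount, nsmul_eq_mul, abs_mul, hC, mul_one, Nat.abs_cast]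

/-- Reversal flips `ltSign`. For a short arc `u + v` is odd; for a long one the left end becomes `N
- 1 - max u v`, and `N - 1` is odd. -/
theorem arcWeight_rev {N : ℕ} (hN : Even N) {H : SimpleGraph (Fin N)}
    (hrev : ∀ u v : Fin N, H.Adj u.rev v.rev ↔ H.Adj u v) (u v : Fin N) :
    arcWeight H u.rev v.rev = (-1) ^ (u.1 + v.1) * arcWeight H u v := by
  unfold arcWeight
  by_cases h : H.Adj u v
  swap
  · rw [if_neg (mt (hrev u v).1 h), if_neg h, mul_zero]
  have huv : u.1 ≠ v.1 := fun h' => h.ne (Fin.ext h')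
  have hu := u.2
  have hv := v.2
  have hlt : ltSign u.rev v.rev = -ltSign u v := by
    unfold ltSign
    simp only [Fin.val_rev]
    split_ifs <;> first | rfl | omega
  have hshort : (u.rev.1 + 1 = v.rev.1 ∨ v.rev.1 + 1 = u.rev.1) ↔ (u.1 + 1 = v ∨ v.1 + 1 = u) := by
    simp only [Fin.val_rev]
    omega
  rw [if_pos ((hrev u v).2 h), if_pos h, hlt, if_congr hshort rfl rfl]
  split_ifs with h1
  · rw [Odd.neg_one_pow (by grind)]
    ring
  · have hmin : Odd (min u.rev.1 v.rev.1 + (u.1 + v.1) + min u.1 v.1) := by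
      simp only [Fin.val_rev]
      rcases lt_or_gt_of_ne huv with h' | h'
      · rw [min_eq_right (by omega), min_eq_left h'.le]
        grind
      · rw [min_eq_left (by omega), min_eq_right h'.le]
        grind
    have h3 := hmin.neg_one_pow (α := ℤ)
    rw [pow_add, pow_add] at h3
    have h4 : ∀ k : ℕ, ((-1 : ℤ) ^ k) * (-1) ^ k = 1 := fun k => by
      rw [← mul_pow]
      simp
    linear_combination -ltSign u v * (-1) ^ (u.1 + v.1) * (-1) ^ (min u.1 v.1) * h3 +
      ltSign u v * (-1) ^ (min u.rev.1 v.rev.1) * (-1) ^ (min u.1 v.1) * (-1) ^ (min u.1 v.1) *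
        h4 (u.1 + v.1) + ltSign u v * (-1) ^ (min u.rev.1 v.rev.1) * h4 (min u.1 v.1)

theorem exists_numPerfectMatchings_eq_of_rev {N : ℕ} {H : SimpleGraph (Fin N)} {p : Fin N → Prop}
    (hp : ∀ u v, H.Adj u v → (p u ↔ ¬p v)) (hprev : ∀ u : Fin N, p u.rev ↔ p u)
    (hnest : ∀ a b c d : Fin N, a < b → b < c → c < d → H.Adj a d → H.Adj b c → b.1 + 1 = c)
    (hrev : ∀ u v : Fin N, H.Adj u.rev v.rev ↔ H.Adj u v) :
    ∃ a b : ℤ, (numPerfectMatchings H : ℤ) = a ^ 2 + b ^ 2 := by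
  classical
  by_cases h0 : numPerfectMatchings H = 0
  · exact ⟨0, 0, by simp [h0]⟩
  obtain ⟨M, hM⟩ := Set.nonempty_of_ncard_ne_zero h0
  -- A matching is needed here: it makes `N` even, so that reversal exchanges even and odd numbers,
  -- and it balances the colours.
  have hN : Even N := by simpa using SimpleGraph.Subgraph.IsPerfectMatching.even_card hM
  rw [numPerfectMatchings_eq_card_equiv H p hp] at h0
  obtain ⟨⟨f, -⟩⟩ := (Nat.card_ne_zero.1 h0).1
  -- representatives of the orbits of the reversal
  have split : ∀ q : Fin N → Prop, (∀ u : Fin N, q u.rev ↔ q u) →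
      ∃ e : {v : Fin N // q v ∧ Even v.1} ⊕ {v : Fin N // q v ∧ Even v.1} ≃ {v // q v},
        (∀ x, (e (Sum.inl x)).1 = x.1) ∧ ∀ x, (e (Sum.inr x)).1 = x.1.rev := by
    intro q hq
    have hpar : ∀ u : Fin N, Even u.rev.1 ↔ ¬Even u.1 := by
      intro u
      have := u.2
      rw [Fin.val_rev]
      grind
    let g : {v : Fin N // q v ∧ Even v.1} ⊕ {v : Fin N // q v ∧ Even v.1} → {v // q v} :=
      Sum.elim (fun x => ⟨x.1, x.2.1⟩) (fun x => ⟨x.1.rev, (hq _).2 x.2.1⟩)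
    refine ⟨Equiv.ofBijective g ⟨?_, ?_⟩, fun _ => rfl, fun _ => rfl⟩
    · rintro (x | x) (y | y) h <;> simp only [g, Sum.elim_inl, Sum.elim_inr, Subtype.mk.injEq] at h
      · rw [Subtype.ext h]
      · exact absurd y.2.2 ((hpar _).1 (h ▸ x.2.2))
      · exact absurd x.2.2 ((hpar _).1 (h ▸ y.2.2))
      · rw [Subtype.ext (Fin.rev_injective h)]
    · rintro ⟨v, hv⟩
      by_cases h : Even v.1
      · exact ⟨Sum.inl ⟨v, hv, h⟩, rfl⟩
      · exact ⟨Sum.inr ⟨v.rev, (hq v).2 hv, (hpar v).2 h⟩, Subtype.ext (Fin.rev_rev v)⟩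
  obtain ⟨sB, hB₁, hB₂⟩ := split p hprev
  obtain ⟨sW, hW₁, hW₂⟩ := split (fun v => ¬p v) (fun u => not_congr (hprev u))
  have hcard : Fintype.card {v : Fin N // p v ∧ Even v.1} =
      Fintype.card {v : Fin N // ¬p v ∧ Even v.1} := by
    have h1 := Fintype.card_congr sB
    have h2 := Fintype.card_congr sW
    have h3 := Fintype.card_congr f
    rw [Fintype.card_sum] at h1 h2
    omega
  -- Any bijection will do: it only orders the columns, which leaves the absolute value of the
  -- determinant unchanged.
  let g : {v : Fin N // p v ∧ Even v.1} ≃ {v : Fin N // ¬p v ∧ Even v.1} :=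
    Fintype.equivOfCardEq hcard
  let eB := Fintype.orderIsoFinOfCardEq {v // p v} rfl
  let eW := Fintype.orderIsoFinOfCardEq {v // ¬p v} (Fintype.card_congr f).symm
  let A := of fun i j => arcWeight H (eB i).1 (eW j).1
  let P : Matrix {v : Fin N // p v ∧ Even v.1} {v : Fin N // p v ∧ Even v.1} ℤ :=
    of fun x y => arcWeight H x.1 (g y).1
  let Q : Matrix {v : Fin N // p v ∧ Even v.1} {v : Fin N // p v ∧ Even v.1} ℤ :=
    of fun x y => arcWeight H x.1 (g y).1.rev
  have hblock : A.submatrix (sB.trans eB.symm.toEquiv)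
      (((Equiv.sumCongr g g).trans sW).trans eW.symm.toEquiv) = fromBlocks P Q (-Q) P := by
    ext (x | x) (y | y)
    · simp [A, P, hB₁, hW₁]
    · simp [A, Q, hB₁, hW₂]
    · have h := arcWeight_rev hN hrev x.1 (g y).1.rev
      rw [Fin.rev_rev, Odd.neg_one_pow] at h
      · simp [A, Q, hB₂, hW₁, h]
      · have := (g y).2.2
        have := x.2.2
        have := (g y).1.2
        rw [Fin.val_rev]
        grind
    · have h := arcWeight_rev hN hrev x.1 (g y).1
      rw [Even.neg_one_pow (x.2.2.add (g y).2.2), one_mul] at h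
      simp [A, P, hB₂, hW₂, h]
  obtain ⟨a, b, hab⟩ := exists_det_fromBlocks_eq_sq_add_sq P Q
  refine ⟨a, b, ?_⟩
  rw [← abs_det_arcWeight hp hnest eB eW, ← abs_of_nonneg (by positivity : 0 ≤ a ^ 2 + b ^ 2), ← hab,
    ← hblock, abs_det_submatrix_equiv_equiv]

/-! ### The row order on the lattice -/

theorem squareLattice_adj_iff {p q : ℤ × ℤ} : squareLattice.Adj p q ↔
    (p.2 = q.2 ∧ (p.1 + 1 = q.1 ∨ q.1 + 1 = p.1)) ∨
      (p.1 = q.1 ∧ (p.2 + 1 = q.2 ∨ q.2 + 1 = p.2)) := by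
  change |p.1 - q.1| + |p.2 - q.2| = 1 ↔ _
  rcases abs_cases (p.1 - q.1) with h | h <;> rcases abs_cases (p.2 - q.2) with h' | h' <;> omega

theorem halfTurn_apply (c p : ℤ × ℤ) :
    halfTurn c p = (2 * c.1 + 1 - p.1, 2 * c.2 + 1 - p.2) := rfl

theorem halfTurn_halfTurn (c p : ℤ × ℤ) : halfTurn c (halfTurn c p) = p := by
  ext <;> simp [halfTurn_apply]

/-- The points of the lattice ordered by rows, and from left to right in each row. -/
def rowOrder (p : ℤ × ℤ) : ℤ ×ₗ ℤ := toLex (p.2, p.1)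

theorem rowOrder_lt {p q : ℤ × ℤ} :
    rowOrder p < rowOrder q ↔ p.2 < q.2 ∨ p.2 = q.2 ∧ p.1 < q.1 :=
  Prod.Lex.toLex_lt_toLex

theorem rowOrder_injective : Function.Injective rowOrder := fun p q h => by
  have := congrArg ofLex h
  simp only [rowOrder, ofLex_toLex, Prod.mk.injEq] at this
  exact Prod.ext this.2 this.1

/-- A finite set of lattice points can be enumerated by rows. -/
theorem exists_enum_rowOrder {s : Set (ℤ × ℤ)} (hs : s.Finite) :
    ∃ (N : ℕ) (x : Fin N → ℤ × ℤ), StrictMono (rowOrder ∘ x) ∧ Set.range x = s := by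
  classical
  let S : Finset (ℤ ×ₗ ℤ) := hs.toFinset.image rowOrder
  let e : Fin #S ↪o ℤ ×ₗ ℤ := S.orderEmbOfFin rfl
  have he : Set.range e = rowOrder '' s := by
    rw [S.range_orderEmbOfFin rfl]
    simp [S]
  have hx : ∀ i, ∃ p ∈ s, rowOrder p = e i := fun i => he.subset ⟨i, rfl⟩
  choose x hxs hxe using hx
  refine ⟨#S, x, ?_, Set.Subset.antisymm (Set.range_subset_iff.2 hxs) fun p hp => ?_⟩
  · rw [show rowOrder ∘ x = e from funext hxe]
    exact e.strictMono
  · obtain ⟨i, hi⟩ := he.superset ⟨p, hp, rfl⟩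
    exact ⟨i, rowOrder_injective ((hxe i).trans hi)⟩

/-- In the enumeration by rows of a set invariant under a half-turn, the half-turn is the
reversal. -/
theorem enum_rev_eq_halfTurn {N : ℕ} {x : Fin N → ℤ × ℤ} (hx : StrictMono (rowOrder ∘ x))
    {c : ℤ × ℤ} (hc : ∀ p ∈ Set.range x, halfTurn c p ∈ Set.range x) (i : Fin N) :
    x i.rev = halfTurn c (x i) := by
  -- The half-turn reverses the row order, so composing it with `Fin.rev` gives a second increasing
  -- enumeration of the same set, hence the same one.
  have hf : StrictMono fun i : Fin N => rowOrder (halfTurn c (x i.rev)) := by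
    intro i j hij
    have := hx (Fin.rev_lt_rev.2 hij)
    simp only [Function.comp_apply, rowOrder_lt, halfTurn_apply] at this ⊢
    omega
  have h := (hf.range_inj hx).1 (by
    ext y
    constructor
    · rintro ⟨i, rfl⟩
      obtain ⟨j, hj⟩ := hc _ ⟨i.rev, rfl⟩
      exact ⟨j, congrArg rowOrder hj⟩
    · rintro ⟨i, rfl⟩
      obtain ⟨j, hj⟩ := hc _ ⟨i, rfl⟩
      refine ⟨j.rev, ?_⟩
      simp [hj, halfTurn_halfTurn])
  have := rowOrder_injective (congrFun h i.rev)
  rw [Fin.rev_rev] at this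
  exact this.symm

/-- In the enumeration by rows, arcs nested under an edge join consecutive points. -/
theorem enum_succ_eq_of_nested {N : ℕ} {x : Fin N → ℤ × ℤ} (hx : StrictMono (rowOrder ∘ x))
    {i j k l : Fin N} (hij : i < j) (hjk : j < k) (hkl : k < l)
    (hil : squareLattice.Adj (x i) (x l)) (hjk' : squareLattice.Adj (x j) (x k)) :
    j.1 + 1 = k := by
  by_contra hne
  have hjk₁ := Fin.lt_def.1 hjk
  have hk := k.2
  -- The inner edge must be horizontal, leaving no lattice point strictly between its ends for `x
  -- m`.
  let m : Fin N := ⟨j.1 + 1, by omega⟩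
  have h₁ := hx hij
  have h₂ := hx hjk
  have h₃ := hx hkl
  have h₄ := hx (Fin.lt_def.2 (Nat.lt_succ_self j.1) : j < m)
  have h₅ := hx (Fin.lt_def.2 (by simp only [m]; omega) : m < k)
  simp only [Function.comp_apply, rowOrder_lt] at h₁ h₂ h₃ h₄ h₅
  rw [squareLattice_adj_iff] at hil hjk'
  omega

theorem mainTheorem5 (c : ℤ × ℤ) (G : squareLattice.Subgraph) (hfin : G.verts.Finite)
    (hG : IsTwoEvenSymmetric c G) :
    ∃ a b : ℤ, (numPerfectMatchings G.coe : ℤ) = a ^ 2 + b ^ 2 := by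
  have hverts : ∀ p ∈ G.verts, halfTurn c p ∈ G.verts := fun p hp => by
    rw [← hG.map_halfTurn]
    exact ⟨p, hp, rfl⟩
  have hadj : ∀ p q, G.Adj p q → G.Adj (halfTurn c p) (halfTurn c q) := fun p q h => by
    rw [← hG.map_halfTurn]
    exact ⟨p, q, h, rfl, rfl⟩
  obtain ⟨N, x, hx, hrange⟩ := exists_enum_rowOrder hfin
  have hrev := enum_rev_eq_halfTurn hx (c := c) (by rwa [hrange])
  have hinj : Function.Injective x := hx.injective.of_comp
  let H : SimpleGraph (Fin N) :=
    { Adj := fun i j => G.Adj (x i) (x j)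
      symm := ⟨fun i j h => h.symm⟩
      loopless := ⟨fun i h => (G.adj_sub h).ne rfl⟩ }
  let e : H ≃g G.coe :=
    { toEquiv := (Equiv.ofInjective x hinj).trans (Equiv.setCongr hrange)
      map_rel_iff' := Iff.rfl }
  rw [← numPerfectMatchings_congr e]
  -- Checkerboard colouring: the half-turn sends the coordinate sum `s` to `2 * c.1 + 2 * c.2 + 2 -
  -- s`, so it preserves colours.
  refine exists_numPerfectMatchings_eq_of_rev (p := fun i => Even ((x i).1 + (x i).2)) ?_ ?_ ?_ ?_
  · intro i j h
    have := squareLattice_adj_iff.1 (G.adj_sub h)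
    grind
  · intro i
    simp only [hrev, halfTurn_apply]
    grind
  · intro i j k l hij hjk hkl hil hjk'
    exact enum_succ_eq_of_nested hx hij hjk hkl (G.adj_sub hil) (G.adj_sub hjk')
  · intro i j
    change G.Adj _ _ ↔ G.Adj _ _
    rw [hrev, hrev]
    refine ⟨fun h => ?_, hadj _ _⟩
    have := hadj _ _ h
    rwa [halfTurn_halfTurn, halfTurn_halfTurn] at this
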